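/- A *p-algebra* is a bounded distributive lattice with an additional unary operation ${}^*$ satisfying $x\wedge y=0 \iff x\le y^*$; let $\mathsf{Pa}$ be the class of all p-algebras. For $m\in\mathbb N$ let $\bar{\mathbf B}_m$ be the p-algebra obtained from the Boolean algebra with $m$ atoms by adding a new element above its top element, and let $\mathsf{Pa}_m=\mathbf{HSP}(\bar{\mathbf B}_m)$ be the variety it generates. A subquasivariety of $\mathsf{Pa}$ is a class of p-algebras axiomatized, within $\mathsf{Pa}$, by a set of quasi-identities; these classes are ordered by inclusion. A subquasivariety $\mathsf K$ is a cover of $\mathsf{Pa}_m$ if $\mathsf{Pa}_m\subsetneq\mathsf K$ and no subquasivariety $\mathsf L$ satisfies $\mathsf{Pa}_m\subsetneq\mathsf L\subsetneq\mathsf K$. **Theorem.** For every $m\ge 2$, the variety $\mathsf{Pa}_m$ has exactly one cover in the lattice of subquasivarieties of $\mathsf{Pa}$. -/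

import Mathlib

universe u v w

namespace PAlgebras

/-! ### p-algebras and their homomorphisms -/

/-- A (distributive) p-algebra: a bounded distributive lattice with a unary operation `pc`
(written `*` in the literature) such that `x ⊓ y = ⊥` iff `x ≤ y*`. -/
class PAlgebra (A : Type u) extends DistribLattice A, BoundedOrder A where
  pc : A → A
  inf_eq_bot_iff : ∀ x y : A, x ⊓ y = ⊥ ↔ x ≤ pc y

/-- A map between p-algebras is a homomorphism if it preserves all the operations. -/
structure IsHom {A : Type u} {B : Type v} [PAlgebra A] [PAlgebra B] (f : A → B) : Prop where
  map_bot : f ⊥ = ⊥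
  map_top : f ⊤ = ⊤
  map_inf : ∀ x y, f (x ⊓ y) = f x ⊓ f y
  map_sup : ∀ x y, f (x ⊔ y) = f x ⊔ f y
  map_pc : ∀ x, f (PAlgebra.pc x) = PAlgebra.pc (f x)

/-- The class `Pa` of all p-algebras (with carrier in `Type u`). -/
structure PAlg : Type (u + 1) where
  carrier : Type u
  [str : PAlgebra carrier]

attribute [instance] PAlg.str

/-- Direct products of p-algebras, with the coordinatewise operations. -/
instance instPAlgebraPi {I : Type u} (F : I → Type v) [∀ i, PAlgebra (F i)] :
    PAlgebra (∀ i, F i) where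
  pc x := fun i => PAlgebra.pc (x i)
  inf_eq_bot_iff x y := by
    rw [funext_iff, Pi.le_def]
    exact forall_congr' fun i => PAlgebra.inf_eq_bot_iff (x i) (y i)

/-! ### The class operators `H`, `S`, `P` (classes are closed under isomorphic copies) -/

/-- Homomorphic images of members of `K`. -/
def classH (K : Set PAlg.{u}) : Set PAlg.{u} :=
  {A | ∃ B ∈ K, ∃ f : B.carrier → A.carrier, IsHom f ∧ Function.Surjective f}

/-- Algebras isomorphic to a subalgebra of a member of `K`. -/
def classS (K : Set PAlg.{u}) : Set PAlg.{u} :=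
  {A | ∃ B ∈ K, ∃ f : A.carrier → B.carrier, IsHom f ∧ Function.Injective f}

/-- Algebras isomorphic to a direct product of a (possibly empty) family of members of `K`. -/
def classP (K : Set PAlg.{u}) : Set PAlg.{u} :=
  {A | ∃ (I : Type u) (F : I → PAlg.{u}), (∀ i, F i ∈ K) ∧
    ∃ f : A.carrier → (∀ i, (F i).carrier), IsHom f ∧ Function.Bijective f}

/-! ### Terms, quasi-identities, quasivarieties -/

/-- Terms in the language of p-algebras. -/
inductive Term (X : Type u) : Type u where
  | var : X → Term X
  | bot : Term X
  | top : Term X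
  | inf : Term X → Term X → Term X
  | sup : Term X → Term X → Term X
  | pc : Term X → Term X

/-- The value of a term under an assignment of the variables. -/
def Term.eval {X : Type u} {A : Type v} [PAlgebra A] (a : X → A) : Term X → A
  | .var x => a x
  | .bot => ⊥
  | .top => ⊤
  | .inf s t => s.eval a ⊓ t.eval a
  | .sup s t => s.eval a ⊔ t.eval a
  | .pc t => PAlgebra.pc (t.eval a)

/-- A quasi-identity `s₁ = t₁ ∧ … ∧ sₙ = tₙ → s = t` (with `n = 0` allowed). -/
structure QuasiIdentity : Type where
  premises : List (Term ℕ × Term ℕ)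
  lhs : Term ℕ
  rhs : Term ℕ

/-- Validity of a quasi-identity in a p-algebra. -/
def QuasiIdentity.Holds (q : QuasiIdentity) (A : Type u) [PAlgebra A] : Prop :=
  ∀ a : ℕ → A, (∀ e ∈ q.premises, e.1.eval a = e.2.eval a) → q.lhs.eval a = q.rhs.eval a

/-- A class of p-algebras is a quasivariety if it is axiomatized, within the class of all
p-algebras, by a set of quasi-identities. -/
def IsQuasivariety (K : Set PAlg.{u}) : Prop :=
  ∃ E : Set QuasiIdentity, K = {A | ∀ q ∈ E, q.Holds A.carrier}

/-- The subquasivarieties of `Pa`. -/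
structure Subquasivariety : Type (u + 1) where
  carrier : Set PAlg.{u}
  isQuasivariety : IsQuasivariety carrier

/-- Subquasivarieties are ordered by inclusion. -/
instance instPartialOrderSubquasivariety : PartialOrder Subquasivariety.{u} :=
  PartialOrder.lift Subquasivariety.carrier fun K L h => by
    cases K; cases L; cases h; rfl

/-! ### The algebras `B̄ₘ` -/

/-- The Boolean algebra with `m` atoms (the subsets of an `m`-element set), with a new element
placed on top of its top element. -/
abbrev BBar (m : ℕ) : Type u := WithTop (Set (ULift.{u} (Fin m)))

open Classical in
/-- The pseudocomplement of `BBar m`. -/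
noncomputable def BBar.pc {m : ℕ} : BBar.{u} m → BBar.{u} m
  | ⊤ => ⊥
  | (s : Set (ULift.{u} (Fin m))) => if s = ∅ then ⊤ else (sᶜ : Set (ULift.{u} (Fin m)))

noncomputable instance instPAlgebraBBar (m : ℕ) : PAlgebra (BBar.{u} m) where
  pc := BBar.pc
  inf_eq_bot_iff x y := by
    induction y using WithTop.recTopCoe with
    | top => simp [BBar.pc]
    | coe t =>
      by_cases ht : t = ∅
      · subst ht
        have h0 : ((∅ : Set (ULift.{u} (Fin m))) : BBar.{u} m) = ⊥ := rfl
        simp [BBar.pc, h0]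
      · induction x using WithTop.recTopCoe with
        | top => simp [BBar.pc, ht, ← WithTop.coe_bot]
        | coe s =>
          simp only [BBar.pc, ht, if_false, ← WithTop.coe_inf, ← WithTop.coe_bot,
            WithTop.coe_inj, WithTop.coe_le_coe]
          rw [← disjoint_iff]
          exact le_compl_iff_disjoint_right.symm

/-! ### Birkhoff's theorem for the variety generated by one algebra -/

theorem IsHom.map_eval {A : Type u} {B : Type v} [PAlgebra A] [PAlgebra B] {f : A → B}
    (hf : IsHom f) {X : Type w} (a : X → A) (t : Term X) :
    f (t.eval a) = t.eval (fun x => f (a x)) := by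
  induction t with
  | var x => rfl
  | bot => exact hf.map_bot
  | top => exact hf.map_top
  | inf s t hs ht => simp only [Term.eval, hf.map_inf, hs, ht]
  | sup s t hs ht => simp only [Term.eval, hf.map_sup, hs, ht]
  | pc t ht => simp only [Term.eval, hf.map_pc, ht]

/-- The evaluation at a coordinate of a product is a homomorphism. -/
theorem isHom_apply {I : Type u} (F : I → Type v) [∀ i, PAlgebra (F i)] (i : I) :
    IsHom (fun x : (∀ i, F i) => x i) where
  map_bot := rfl
  map_top := rfl
  map_inf _ _ := rfl
  map_sup _ _ := rfl
  map_pc _ := rfl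

/-- Substitution of variables. -/
def Term.rename {X : Type u} {Y : Type v} (r : X → Y) : Term X → Term Y
  | .var x => .var (r x)
  | .bot => .bot
  | .top => .top
  | .inf s t => .inf (s.rename r) (t.rename r)
  | .sup s t => .sup (s.rename r) (t.rename r)
  | .pc t => .pc (t.rename r)

theorem Term.eval_rename {X : Type u} {Y : Type v} {A : Type w} [PAlgebra A] (r : X → Y)
    (a : Y → A) (t : Term X) : (t.rename r).eval a = t.eval (fun x => a (r x)) := by
  induction t <;> simp_all [Term.eval, Term.rename]

/-- The set of variables of a term. -/
def Term.vars {X : Type u} : Term X → Set X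
  | .var x => {x}
  | .bot => ∅
  | .top => ∅
  | .inf s t => s.vars ∪ t.vars
  | .sup s t => s.vars ∪ t.vars
  | .pc t => t.vars

theorem Term.finite_vars {X : Type u} (t : Term X) : t.vars.Finite := by
  induction t <;> simp_all [Term.vars]

theorem Term.eval_congr {X : Type u} {A : Type v} [PAlgebra A] {a b : X → A} (t : Term X)
    (h : ∀ x ∈ t.vars, a x = b x) : t.eval a = t.eval b := by
  induction t with
  | var x => exact h x rfl
  | bot => rfl
  | top => rfl
  | inf s t hs ht =>
    simp only [Term.eval, hs fun x hx => h x (Or.inl hx), ht fun x hx => h x (Or.inr hx)]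
  | sup s t hs ht =>
    simp only [Term.eval, hs fun x hx => h x (Or.inl hx), ht fun x hx => h x (Or.inr hx)]
  | pc t ht => simp only [Term.eval, ht h]

/-- If all identities (in the variables indexed by `ℕ`) of `B` hold in `A`, then so do its
identities in any set of variables. -/
theorem eval_eq_of_identities {A : Type u} {B : Type v} [PAlgebra A] [PAlgebra B]
    (h : ∀ s t : Term ℕ, (∀ b : ℕ → B, s.eval b = t.eval b) →
      ∀ a : ℕ → A, s.eval a = t.eval a)
    {X : Type w} (s t : Term X) (hst : ∀ b : X → B, s.eval b = t.eval b) (a : X → A) :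
    s.eval a = t.eval a := by
  classical
  have hfin : (s.vars ∪ t.vars).Finite := s.finite_vars.union t.finite_vars
  obtain ⟨r, hr⟩ := Set.countable_iff_exists_injOn.1 hfin.countable
  have key := h (s.rename r) (t.rename r) (fun b => by
    rw [Term.eval_rename, Term.eval_rename]; exact hst _)
    (fun n => if hn : ∃ x ∈ s.vars ∪ t.vars, r x = n then a hn.choose else ⊥)
  rw [Term.eval_rename, Term.eval_rename] at key
  have aux : ∀ x ∈ s.vars ∪ t.vars,
      (if hn : ∃ y ∈ s.vars ∪ t.vars, r y = r x then a hn.choose else ⊥) = a x := by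
    intro x hx
    have hn : ∃ y ∈ s.vars ∪ t.vars, r y = r x := ⟨x, hx, rfl⟩
    rw [dif_pos hn]
    exact congrArg a (hr hn.choose_spec.1 hx hn.choose_spec.2)
  rwa [Term.eval_congr s fun x hx => aux x (Or.inl hx),
    Term.eval_congr t fun x hx => aux x (Or.inr hx)] at key

/-- The p-algebra structure on the range of an evaluation map. -/
@[reducible] def rangeEval {X : Type u} {A : Type v} [PAlgebra A] (a : X → A) :
    PAlgebra (Set.range (fun t : Term X => t.eval a)) :=
  letI : Max (Set.range (fun t : Term X => t.eval a)) :=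
    ⟨fun x y => ⟨x.1 ⊔ y.1, by
      obtain ⟨_, s, rfl⟩ := x; obtain ⟨_, t, rfl⟩ := y; exact ⟨.sup s t, rfl⟩⟩⟩
  letI : Min (Set.range (fun t : Term X => t.eval a)) :=
    ⟨fun x y => ⟨x.1 ⊓ y.1, by
      obtain ⟨_, s, rfl⟩ := x; obtain ⟨_, t, rfl⟩ := y; exact ⟨.inf s t, rfl⟩⟩⟩
  { Subtype.val_injective.distribLattice (Subtype.val) Iff.rfl Iff.rfl
      (fun _ _ => rfl) (fun _ _ => rfl) with
    top := ⟨⊤, .top, rfl⟩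
    bot := ⟨⊥, .bot, rfl⟩
    le_top := fun x => le_top (a := x.1)
    bot_le := fun x => bot_le (a := x.1)
    pc := fun x => ⟨PAlgebra.pc x.1, by obtain ⟨_, s, rfl⟩ := x; exact ⟨.pc s, rfl⟩⟩
    inf_eq_bot_iff := fun x y =>
      Subtype.ext_iff.trans (PAlgebra.inf_eq_bot_iff x.1 y.1) }

theorem mem_HSP_iff (B A : PAlg.{u}) : A ∈ classH (classS (classP {B})) ↔
    ∀ s t : Term ℕ, (∀ b : ℕ → B.carrier, s.eval b = t.eval b) →
      ∀ a : ℕ → A.carrier, s.eval a = t.eval a := by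
  constructor
  · rintro ⟨C, ⟨D, ⟨I, F, hF, e, he, hebij⟩, g, hg, hginj⟩, f, hf, hfsurj⟩ s t hst a
    choose c hc using fun n => hfsurj (a n)
    obtain rfl : (fun n => f (c n)) = a := funext hc
    rw [← hf.map_eval, ← hf.map_eval]
    congr 1
    apply hginj
    rw [hg.map_eval, hg.map_eval]
    apply hebij.1
    rw [he.map_eval, he.map_eval]
    funext i
    have h1 := fun r : Term ℕ =>
      (isHom_apply (fun i => (F i).carrier) i).map_eval (fun x => e (g (c x))) r
    rw [h1, h1]
    have hi : F i = B := hF i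
    rw [← hi] at hst
    exact hst _
  · intro h
    let ev : A.carrier → ((A.carrier → B.carrier) → B.carrier) := fun x b => b x
    let _ := rangeEval ev
    have hev : ∀ (r : Term A.carrier) (b : A.carrier → B.carrier), (r.eval ev) b = r.eval b :=
      fun r b => (isHom_apply (fun _ => B.carrier) b).map_eval ev r
    have hwd : ∀ r r' : Term A.carrier, r.eval ev = r'.eval ev → r.eval id = r'.eval id :=
      fun r r' hr => eval_eq_of_identities h r r' (fun b => by
        rw [← hev, ← hev, hr]) id
    let f : Set.range (fun t : Term A.carrier => t.eval ev) → A.carrier :=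
      fun x => x.2.choose.eval id
    have hf : ∀ (x : Set.range (fun t : Term A.carrier => t.eval ev)) (r : Term A.carrier),
        x.1 = r.eval ev → f x = r.eval id :=
      fun x r hr => hwd _ _ (x.2.choose_spec.trans hr)
    refine ⟨⟨Set.range (fun t : Term A.carrier => t.eval ev)⟩,
      ⟨⟨(A.carrier → B.carrier) → B.carrier⟩, ⟨A.carrier → B.carrier, fun _ => B, fun _ => rfl,
        id, ⟨rfl, rfl, fun _ _ => rfl, fun _ _ => rfl, fun _ => rfl⟩, Function.bijective_id⟩,
        Subtype.val, ⟨rfl, rfl, fun _ _ => rfl, fun _ _ => rfl, fun _ => rfl⟩,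
        Subtype.val_injective⟩, f, ⟨?_, ?_, ?_, ?_, ?_⟩, ?_⟩
    · exact hf _ .bot rfl
    · exact hf _ .top rfl
    · rintro ⟨_, s, rfl⟩ ⟨_, t, rfl⟩
      rw [hf ⟨_, s, rfl⟩ s rfl, hf ⟨_, t, rfl⟩ t rfl]
      exact hf _ (.inf s t) rfl
    · rintro ⟨_, s, rfl⟩ ⟨_, t, rfl⟩
      rw [hf ⟨_, s, rfl⟩ s rfl, hf ⟨_, t, rfl⟩ t rfl]
      exact hf _ (.sup s t) rfl
    · rintro ⟨_, s, rfl⟩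
      rw [hf ⟨_, s, rfl⟩ s rfl]
      exact hf _ (.pc s) rfl
    · exact fun x => ⟨⟨_, .var x, rfl⟩, hf _ (.var x) rfl⟩

theorem isQuasivariety_HSP (B : PAlg.{u}) : IsQuasivariety (classH (classS (classP {B}))) := by
  refine ⟨{q | q.premises = [] ∧ q.Holds B.carrier}, ?_⟩
  ext A
  rw [mem_HSP_iff]
  constructor
  · rintro h ⟨p, s, t⟩ ⟨hp, hq⟩ a -
    obtain rfl : p = [] := hp
    exact h s t (fun b => hq b (by simp)) a
  · intro h s t hst a
    exact h ⟨[], s, t⟩ ⟨rfl, fun b _ => hst b⟩ a (by simp)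

/-! ### The varieties `Paₘ` -/

/-- The variety `Paₘ = HSP(B̄ₘ)`, as an element of the poset of subquasivarieties of `Pa`. -/
def Pa (m : ℕ) : Subquasivariety.{u} where
  carrier := classH (classS (classP {⟨BBar.{u} m⟩}))
  isQuasivariety := isQuasivariety_HSP _

end PAlgebras

namespace PAlgebras

open PAlgebra (pc inf_eq_bot_iff)

/-! ### Pseudocomplements -/

section Pseudocomplement

variable {A : Type v} [PAlgebra A]

/-! The cover is found as the least quasivariety strictly above `Pa m`: the one generated by `Pa m`
and a finite algebra `C`, the simplicial complexes on `m + 1` vertices. Two facts suffice. First,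
`C` is not in `Pa m`, since it violates Lee's identity, which holds in `BBar m` because there are
only `m` atoms (`lee_BBar`, `Cplx_notMem_Pa`). Second, `C` lies in every larger quasivariety `L`
(`Cplx_mem_of_lt`).

For the second fact, take `A` in `L` outside `Pa m`. If every prime filter of `A` lay in at most `m`
maximal filters, homomorphisms to `BBar m` would separate the points of `A`; so some prime filter
`p` lies in `m + 1` distinct ones. Separating these by a dense partition `d` yields a homomorphism
`cplxMap d` from `C` to `A`. It need not be injective, but it separates the full simplex from its
boundary, as `p` contains no `pc (d i)`. Any other pair of complexes differs in a simplex with at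
most `m` vertices and is separated by a map to `BBar m`. Hence `C` embeds in a product of members of
`L`. -/

theorem inf_pc_self (a : A) : a ⊓ pc a = ⊥ := by
  rw [inf_comm, inf_eq_bot_iff]

theorem le_pc_comm {a b : A} : a ≤ pc b ↔ b ≤ pc a := by
  rw [← inf_eq_bot_iff, ← inf_eq_bot_iff, inf_comm]

theorem pc_anti {a b : A} (h : a ≤ b) : pc b ≤ pc a := by
  rw [← inf_eq_bot_iff, ← le_bot_iff, ← inf_pc_self b, inf_comm]
  exact inf_le_inf_right _ h

theorem pc_bot : pc (⊥ : A) = ⊤ :=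
  top_le_iff.1 ((inf_eq_bot_iff _ _).1 (by simp))

theorem pc_top : pc (⊤ : A) = ⊥ := by
  simpa using inf_pc_self (⊤ : A)

theorem pc_sup (a b : A) : pc (a ⊔ b) = pc a ⊓ pc b :=
  le_antisymm (le_inf (pc_anti le_sup_left) (pc_anti le_sup_right))
    (le_pc_comm.1 (sup_le (le_pc_comm.1 inf_le_left) (le_pc_comm.1 inf_le_right)))

theorem pc_sup_pc_self (a : A) : pc (a ⊔ pc a) = ⊥ := by
  rw [pc_sup, inf_pc_self]

theorem pc_finset_sup {ι : Type w} (s : Finset ι) (f : ι → A) :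
    pc (s.sup f) = s.inf fun i => pc (f i) := by
  classical
  induction s using Finset.induction_on with
  | empty => simp [pc_bot]
  | insert i s _ ih => rw [Finset.sup_insert, pc_sup, ih, Finset.inf_insert]

end Pseudocomplement

/-! ### Prime filters -/

/-- Prime filters of a p-algebra. -/
structure IsPrimeFilter {A : Type v} [PAlgebra A] (p : Set A) : Prop where
  top_mem : ⊤ ∈ p
  bot_notMem : ⊥ ∉ p
  inf_mem_iff : ∀ a b, a ⊓ b ∈ p ↔ a ∈ p ∧ b ∈ p
  sup_mem_iff : ∀ a b, a ⊔ b ∈ p ↔ a ∈ p ∨ b ∈ p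

/-- Maximal proper filters of a p-algebra. -/
structure IsUltra {A : Type v} [PAlgebra A] (M : Set A) : Prop extends IsPrimeFilter M where
  mem_or_pc_mem : ∀ a, a ∈ M ∨ pc a ∈ M

section Filters

variable {A : Type v} [PAlgebra A]

theorem IsPrimeFilter.mono {p : Set A} (hp : IsPrimeFilter p) {a b : A} (h : a ≤ b)
    (ha : a ∈ p) : b ∈ p := by
  rw [← inf_eq_left.2 h] at ha
  exact ((hp.inf_mem_iff _ _).1 ha).2

theorem IsPrimeFilter.pc_notMem {p : Set A} (hp : IsPrimeFilter p) {a : A} (ha : a ∈ p) :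
    pc a ∉ p := fun h =>
  hp.bot_notMem (inf_pc_self a ▸ (hp.inf_mem_iff _ _).2 ⟨ha, h⟩)

theorem IsUltra.pc_mem_iff {M : Set A} (hM : IsUltra M) {a : A} : pc a ∈ M ↔ a ∉ M :=
  ⟨fun h ha => hM.pc_notMem ha h, fun h => (hM.mem_or_pc_mem a).resolve_left h⟩

theorem IsPrimeFilter.finset_sup_mem_iff {p : Set A} (hp : IsPrimeFilter p) {ι : Type w}
    (s : Finset ι) (f : ι → A) : s.sup f ∈ p ↔ ∃ i ∈ s, f i ∈ p := by
  classical
  induction s using Finset.induction_on with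
  | empty => simp [hp.bot_notMem]
  | insert i s _ ih => simp [hp.sup_mem_iff, ih]

theorem IsPrimeFilter.finset_inf_mem_iff {p : Set A} (hp : IsPrimeFilter p) {ι : Type w}
    (s : Finset ι) (f : ι → A) : s.inf f ∈ p ↔ ∀ i ∈ s, f i ∈ p := by
  classical
  induction s using Finset.induction_on with
  | empty => simp [hp.top_mem]
  | insert i s _ ih => simp [hp.inf_mem_iff, ih]

theorem IsUltra.eq_of_subset {M N : Set A} (hM : IsUltra M) (hN : IsUltra N) (h : M ⊆ N) :
    M = N :=
  h.antisymm fun _ ha => by_contra fun hna => hN.pc_notMem ha (h (hM.pc_mem_iff.2 hna))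

/-- The prime filter theorem, for a filter given as a set. -/
theorem exists_isPrimeFilter {F : Set A} (htop : ⊤ ∈ F)
    (hinf : ∀ a ∈ F, ∀ b ∈ F, a ⊓ b ∈ F) (hup : ∀ a ∈ F, ∀ b, a ≤ b → b ∈ F) {y : A}
    (hy : y ∉ F) : ∃ p, IsPrimeFilter p ∧ F ⊆ p ∧ y ∉ p := by
  have hF : Order.IsPFilter F :=
    Order.IsPFilter.of_def ⟨⊤, htop⟩
      (fun a ha b hb => ⟨a ⊓ b, hinf a ha b hb, inf_le_left, inf_le_right⟩)
      (fun hab ha => hup _ ha _ hab)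
  obtain ⟨J, hJ, hyJ, hd⟩ := DistribLattice.prime_ideal_of_disjoint_filter_ideal
    (F := hF.toPFilter) (I := Order.Ideal.principal y)
    (Set.disjoint_left.2 fun a ha hay => hy (hup a ha y hay))
  refine ⟨(J : Set A)ᶜ, ⟨?_, ?_, ?_, ?_⟩, ?_, ?_⟩
  · exact Set.disjoint_left.1 hd htop
  · exact fun h => h J.bot_mem
  · intro a b
    constructor
    · exact fun h => ⟨fun ha => h (J.lower inf_le_left ha), fun hb => h (J.lower inf_le_right hb)⟩
    · rintro ⟨ha, hb⟩ h
      exact (hJ.mem_or_mem h).elim ha hb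
  · intro a b
    simp only [Set.mem_compl_iff, SetLike.mem_coe, Order.Ideal.sup_mem_iff]
    tauto
  · exact fun a ha => Set.disjoint_left.1 hd ha
  · exact fun h => h (hyJ (Order.Ideal.mem_principal.2 le_rfl))

theorem exists_isPrimeFilter_of_not_le {x y : A} (h : ¬ x ≤ y) :
    ∃ p : Set A, IsPrimeFilter p ∧ x ∈ p ∧ y ∉ p := by
  obtain ⟨p, hp, hxp, hyp⟩ := exists_isPrimeFilter (F := Set.Ici x) (y := y) le_top
    (fun _ ha _ hb => le_inf ha hb) (fun _ ha _ hab => le_trans ha hab) h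
  exact ⟨p, hp, hxp le_rfl, hyp⟩

/-- The filter generated by `p`, `a` and the dense elements is proper because `pc a ∉ p`. A prime
filter containing every dense element contains each `c ⊔ pc c`, hence is maximal. -/
theorem IsPrimeFilter.exists_isUltra {p : Set A} (hp : IsPrimeFilter p) {a : A}
    (ha : pc a ∉ p) : ∃ M, IsUltra M ∧ p ⊆ M ∧ a ∈ M := by
  obtain ⟨M, hM, hFM, -⟩ := exists_isPrimeFilter
    (F := {z : A | ∃ x ∈ p, ∃ d, pc d = ⊥ ∧ x ⊓ a ⊓ d ≤ z}) (y := ⊥)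
    ⟨⊤, hp.top_mem, ⊤, pc_top, le_top⟩
    (by
      rintro y ⟨x, hx, d, hd, h⟩ y' ⟨x', hx', dd, hd', h'⟩
      refine ⟨x ⊓ x', (hp.inf_mem_iff _ _).2 ⟨hx, hx'⟩, d ⊓ dd, ?_, ?_⟩
      · have h0 : pc (d ⊓ dd) ⊓ d ⊓ dd = ⊥ := by
          rw [inf_assoc, inf_comm, inf_pc_self]
        rw [inf_eq_bot_iff, hd', le_bot_iff, inf_eq_bot_iff, hd, le_bot_iff] at h0
        exact h0
      · refine le_inf (le_trans ?_ h) (le_trans ?_ h')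
        · exact inf_le_inf (inf_le_inf_right _ inf_le_left) inf_le_left
        · exact inf_le_inf (inf_le_inf_right _ inf_le_right) inf_le_right)
    (by
      rintro y ⟨x, hx, d, hd, h⟩ z hz
      exact ⟨x, hx, d, hd, h.trans hz⟩)
    (by
      rintro ⟨x, hx, d, hd, h⟩
      rw [le_bot_iff, inf_eq_bot_iff, hd, le_bot_iff, inf_eq_bot_iff] at h
      exact ha (hp.mono h hx))
  refine ⟨M, ⟨hM, fun c => (hM.sup_mem_iff _ _).1
    (hFM ⟨⊤, hp.top_mem, c ⊔ pc c, pc_sup_pc_self c, inf_le_right⟩)⟩, ?_, ?_⟩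
  · exact fun x hx => hFM ⟨x, hx, ⊤, pc_top, inf_le_left.trans inf_le_left⟩
  · exact hFM ⟨⊤, hp.top_mem, ⊤, pc_top, inf_le_left.trans inf_le_right⟩

end Filters

/-! ### Homomorphisms to `BBar m` -/

theorem pc_BBar_top (m : ℕ) : pc (⊤ : BBar.{u} m) = ⊥ := pc_top

theorem pc_BBar_coe {m : ℕ} {s : Set (ULift.{u} (Fin m))} (hs : s.Nonempty) :
    pc (s : BBar.{u} m) = ((sᶜ : Set (ULift.{u} (Fin m))) : BBar.{u} m) :=
  if_neg hs.ne_empty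

/-- Elements of `p` go to `⊤`, any other `a` to the set of `i` with `a ∈ M i`. Covering is needed
for pseudocomplements: an element in no `M i` goes to `⊥`, so its pseudocomplement must lie in `p`.
Repetitions among the `M i` are harmless. -/
theorem exists_isHom_BBar {A : Type v} [PAlgebra A] {m : ℕ} {p : Set A} (hp : IsPrimeFilter p)
    (M : Fin m → Set A) (hM : ∀ i, IsUltra (M i)) (hpM : ∀ i, p ⊆ M i)
    (hcov : ∀ a, pc a ∉ p → ∃ i, a ∈ M i) :
    ∃ f : A → BBar.{u} m, IsHom f ∧ ∀ a, f a = ⊤ ↔ a ∈ p := by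
  classical
  let g : A → Set (ULift.{u} (Fin m)) := fun a => {i | a ∈ M i.down}
  let f : A → BBar.{u} m := fun a => if a ∈ p then ⊤ else ((g a : Set _) : BBar.{u} m)
  have f_mem : ∀ {a}, a ∈ p → f a = ⊤ := fun h => if_pos h
  have f_notMem : ∀ {a}, a ∉ p → f a = ((g a : Set _) : BBar.{u} m) := fun h => if_neg h
  have g_mem : ∀ {a}, a ∈ p → g a = Set.univ := fun h => Set.eq_univ_of_forall fun i => hpM _ h
  have g_inf : ∀ a b, g (a ⊓ b) = g a ∩ g b := fun a b =>
    Set.ext fun i => (hM _).inf_mem_iff _ _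
  have g_sup : ∀ a b, g (a ⊔ b) = g a ∪ g b := fun a b =>
    Set.ext fun i => (hM _).sup_mem_iff _ _
  have g_pc : ∀ a, g (pc a) = (g a)ᶜ := fun a => Set.ext fun i => (hM _).pc_mem_iff
  have g_bot : g ⊥ = ∅ := Set.eq_empty_of_forall_notMem fun i => (hM _).bot_notMem
  refine ⟨f, ⟨?_, ?_, ?_, ?_, ?_⟩, ?_⟩
  · rw [f_notMem hp.bot_notMem, g_bot]; rfl
  · exact f_mem hp.top_mem
  · intro a b
    by_cases ha : a ∈ p
    · by_cases hb : b ∈ p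
      · rw [f_mem ha, f_mem hb, f_mem ((hp.inf_mem_iff _ _).2 ⟨ha, hb⟩), inf_top_eq]
      · rw [f_mem ha, f_notMem hb, f_notMem fun h => hb ((hp.inf_mem_iff _ _).1 h).2, g_inf,
          g_mem ha, Set.univ_inter, top_inf_eq]
    · rw [f_notMem ha, f_notMem fun h => ha ((hp.inf_mem_iff _ _).1 h).1, g_inf]
      by_cases hb : b ∈ p
      · rw [f_mem hb, g_mem hb, Set.inter_univ, inf_top_eq]
      · rw [f_notMem hb, ← WithTop.coe_inf]; rfl
  · intro a b
    by_cases ha : a ∈ p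
    · rw [f_mem ha, f_mem ((hp.sup_mem_iff _ _).2 (Or.inl ha)), top_sup_eq]
    · by_cases hb : b ∈ p
      · rw [f_mem hb, f_mem ((hp.sup_mem_iff _ _).2 (Or.inr hb)), sup_top_eq]
      · rw [f_notMem ha, f_notMem hb,
          f_notMem fun h => ((hp.sup_mem_iff _ _).1 h).elim ha hb, g_sup, ← WithTop.coe_sup]; rfl
  · intro a
    by_cases ha : a ∈ p
    · rw [f_mem ha, f_notMem (hp.pc_notMem ha), g_pc, g_mem ha, Set.compl_univ, pc_BBar_top]; rfl
    · rw [f_notMem ha]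
      rcases (g a).eq_empty_or_nonempty with h | h
      · rw [h, f_mem]
        · exact pc_bot.symm
        · by_contra h'
          obtain ⟨i, hi⟩ := hcov a h'
          exact (h ▸ (show ULift.up i ∈ g a from hi) : ULift.up i ∈ (∅ : Set _))
      · rw [f_notMem, g_pc, pc_BBar_coe h]
        intro h'
        obtain ⟨i, hi⟩ := h
        exact (hM _).pc_notMem hi (hpM _ h')
  · intro a
    by_cases ha : a ∈ p
    · simp [f_mem ha, ha]
    · simp [f_notMem ha, ha]

/-! ### Quasi-identities and separating families of homomorphisms -/

/-- Separating homomorphisms amount to an embedding in a product. The target may depend on the pair,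
which lets `BBar m` and `A` be used side by side. -/
theorem QuasiIdentity.holds_of_separating (q : QuasiIdentity) {A : Type v} [PAlgebra A]
    (h : ∀ x y : A, x ≠ y → ∃ B : PAlg.{w}, q.Holds B.carrier ∧
      ∃ f : A → B.carrier, IsHom f ∧ f x ≠ f y) : q.Holds A := by
  intro a ha
  by_contra hne
  obtain ⟨B, hB, f, hf, hfne⟩ := h _ _ hne
  apply hfne
  rw [hf.map_eval, hf.map_eval]
  exact hB _ fun e he => by rw [← hf.map_eval, ← hf.map_eval, ha e he]

theorem mem_Pa_of_separating {m : ℕ} {A : PAlg.{u}}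
    (h : ∀ x y : A.carrier, x ≠ y → ∃ f : A.carrier → BBar.{u} m, IsHom f ∧ f x ≠ f y) :
    A ∈ (Pa.{u} m).carrier := by
  refine (mem_HSP_iff _ _).2 fun s t hst a => ?_
  by_contra hne
  obtain ⟨f, hf, hfne⟩ := h _ _ hne
  apply hfne
  rw [hf.map_eval, hf.map_eval]
  exact hst _

theorem BBar_mem_Pa (m : ℕ) : (⟨BBar.{u} m⟩ : PAlg.{u}) ∈ (Pa.{u} m).carrier :=
  mem_Pa_of_separating fun _ _ h =>
    ⟨id, ⟨rfl, rfl, fun _ _ => rfl, fun _ _ => rfl, fun _ => rfl⟩, h⟩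

/-- A p-algebra outside `Pa m` has a prime filter contained in more than `m` maximal filters. -/
theorem exists_isUltra_of_notMem_Pa {m : ℕ} {A : PAlg.{u}} (hA : A ∉ (Pa.{u} m).carrier) :
    ∃ (p : Set A.carrier) (M : Fin (m + 1) → Set A.carrier), IsPrimeFilter p ∧
      (∀ i, IsUltra (M i)) ∧ (∀ i, p ⊆ M i) ∧ Function.Injective M := by
  by_contra hcon
  have key : ∀ p : Set A.carrier, IsPrimeFilter p →
      ∃ f : A.carrier → BBar.{u} m, IsHom f ∧ ∀ a, f a = ⊤ ↔ a ∈ p := by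
    intro p hp
    let U : Set (Set A.carrier) := {M | IsUltra M ∧ p ⊆ M}
    have hU : U.encard ≤ m := by
      by_contra hlt
      have h1 : ((m + 1 : ℕ) : ℕ∞) ≤ U.encard := by
        simpa using Order.add_one_le_of_lt (not_le.1 hlt)
      obtain ⟨T, hTU, hT⟩ := Set.exists_subset_encard_eq h1
      have hTfin : T.Finite := Set.finite_of_encard_eq_coe hT
      have hTc : T.ncard = m + 1 := by
        rw [Set.ncard, hT]; rfl
      have : Finite T := hTfin
      let e : Fin (m + 1) ≃ T := (Finite.equivFinOfCardEq (by simpa using hTc)).symm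
      exact hcon ⟨p, fun i => (e i).1, hp, fun i => (hTU (e i).2).1, fun i => (hTU (e i).2).2,
        Subtype.val_injective.comp e.injective⟩
    -- One maximal filter above `p`, repeated to pad the list to length exactly `m`.
    obtain ⟨M₀, hM₀, hpM₀, -⟩ := hp.exists_isUltra (a := ⊤) (by
      rw [pc_top]; exact hp.bot_notMem)
    have hUfin : U.Finite := Set.finite_of_encard_le_coe hU
    have hUc : U.ncard ≤ m := by
      have := hUfin.cast_ncard_eq ▸ hU
      exact_mod_cast this
    have : Finite U := hUfin
    let e : U ≃ Fin U.ncard := Finite.equivFinOfCardEq rfl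
    let M : Fin m → U := fun i =>
      if h : i.1 < U.ncard then e.symm ⟨i.1, h⟩ else ⟨M₀, hM₀, hpM₀⟩
    refine exists_isHom_BBar hp (fun i => (M i).1) (fun i => (M i).2.1) (fun i => (M i).2.2) ?_
    intro a ha
    obtain ⟨N, hN, hpN, haN⟩ := hp.exists_isUltra ha
    refine ⟨⟨(e ⟨N, hN, hpN⟩).1, (e ⟨N, hN, hpN⟩).2.trans_le hUc⟩, ?_⟩
    simp [M, haN]
  refine hA (mem_Pa_of_separating fun x y hxy => ?_)
  have : ¬ x ≤ y ∨ ¬ y ≤ x := by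
    by_contra h
    push Not at h
    exact hxy (le_antisymm h.1 h.2)
  rcases this with h | h
  · obtain ⟨p, hp, hxp, hyp⟩ := exists_isPrimeFilter_of_not_le h
    obtain ⟨f, hf, hfp⟩ := key p hp
    exact ⟨f, hf, fun h => hyp ((hfp y).1 (h ▸ (hfp x).2 hxp))⟩
  · obtain ⟨p, hp, hyp, hxp⟩ := exists_isPrimeFilter_of_not_le h
    obtain ⟨f, hf, hfp⟩ := key p hp
    exact ⟨f, hf, fun h => hxp ((hfp x).1 (h ▸ (hfp y).2 hyp))⟩

/-! ### Families of pairwise disjoint elements -/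

/-- A finite family of pairwise disjoint elements whose join is dense. -/
structure IsDensePartition {A : Type v} [PAlgebra A] {V : Type w} [Fintype V] (d : V → A) :
    Prop where
  inf_eq_bot : ∀ i j, i ≠ j → d i ⊓ d j = ⊥
  pc_sup_eq_bot : pc (Finset.univ.sup d) = ⊥

/-- Distinct maximal filters are separated by a dense partition. -/
theorem exists_isDensePartition {A : Type v} [PAlgebra A] {V : Type w} [Fintype V] [Nonempty V]
    (M : V → Set A) (hM : ∀ i, IsUltra (M i)) (hinj : Function.Injective M) :
    ∃ d : V → A, IsDensePartition d ∧ ∀ i, d i ∈ M i := by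
  classical
  have hsep : ∀ i j, ∃ c, i ≠ j → c ∈ M i ∧ c ∉ M j := by
    intro i j
    by_cases hij : i = j
    · exact ⟨⊥, fun h => (h hij).elim⟩
    · obtain ⟨c, hc⟩ := Set.not_subset.1 fun h =>
        hij (hinj ((hM i).eq_of_subset (hM j) h))
      exact ⟨c, fun _ => hc⟩
  choose c hc using hsep
  -- `c i j` lies in `M i` but not in `M j`; the factor `pc (c j i)` makes the `d i` pairwise
  -- disjoint.
  let d : V → A := fun i => (Finset.univ.erase i).inf fun j => c i j ⊓ pc (c j i)
  have hd : ∀ i j, i ≠ j → d i ⊓ d j = ⊥ := by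
    intro i j hij
    have hi : d i ≤ c i j := (Finset.inf_le (by simpa using hij.symm)).trans inf_le_left
    have hj : d j ≤ pc (c i j) := (Finset.inf_le (by simpa using hij)).trans inf_le_right
    exact le_bot_iff.1 (inf_pc_self (c i j) ▸ inf_le_inf hi hj)
  have hdM : ∀ i, d i ∈ M i := by
    intro i
    refine ((hM i).finset_inf_mem_iff _ _).2 fun j hj => ?_
    have hji : j ≠ i := Finset.ne_of_mem_erase hj
    exact ((hM i).inf_mem_iff _ _).2 ⟨(hc i j hji.symm).1, (hM i).pc_mem_iff.2 (hc j i hji).2⟩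
  let r : A := pc (Finset.univ.sup d)
  have hr : ∀ i, d i ⊓ r = ⊥ := fun i =>
    le_bot_iff.1 ((inf_le_inf_right r (Finset.le_sup (Finset.mem_univ i))).trans
      (inf_pc_self _).le)
  -- The remainder `r` is added to a single cell, which makes the join dense and keeps the cells
  -- disjoint.
  obtain ⟨o⟩ := ‹Nonempty V›
  let dd : V → A := fun i => if i = o then d i ⊔ r else d i
  have h_le : ∀ i, d i ≤ dd i := by
    intro i
    by_cases h : i = o <;> simp [dd, h]
  refine ⟨dd, ⟨?_, ?_⟩, fun i => (hM i).mono (h_le i) (hdM i)⟩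
  · intro i j hij
    by_cases hi : i = o
    · have hj : j ≠ o := fun h => hij (hi.trans h.symm)
      simp only [dd, hi, hj, if_true, if_false, inf_sup_right]
      rw [← hi, hd i j hij, inf_comm, hr, sup_bot_eq]
    · by_cases hj : j = o
      · simp only [dd, hi, hj, if_true, if_false, inf_sup_left]
        rw [← hj, hd i j hij, hr, sup_bot_eq]
      · simpa [dd, hi, hj] using hd i j hij
  · rw [← le_bot_iff, ← pc_sup_pc_self (Finset.univ.sup d)]
    refine pc_anti (sup_le (Finset.sup_mono_fun fun i _ => h_le i) ?_)
    refine le_trans ?_ (Finset.le_sup (Finset.mem_univ o))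
    simp [dd, r]

/-! ### The p-algebra of simplicial complexes on a finite set of vertices -/

/-- Simplicial complexes with vertices in `V`: downward closed sets of nonempty finite subsets. -/
abbrev Cplx (V : Type u) : Type u := LowerSet {s : Finset V // s.Nonempty}

/-- The largest complex having no vertex in common with a given one. -/
def Cplx.pc {V : Type u} (D : Cplx V) : Cplx V where
  carrier := {s | ∀ i ∈ s.1, ⟨{i}, Finset.singleton_nonempty i⟩ ∉ D}
  lower' := fun _ _ hts hs i hi => hs i (hts hi)

instance instPAlgebraCplx (V : Type u) : PAlgebra (Cplx V) where
  pc := Cplx.pc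
  inf_eq_bot_iff D E := by
    constructor
    · intro h s hs i hi hE
      have : (⟨{i}, Finset.singleton_nonempty i⟩ : {s : Finset V // s.Nonempty}) ∈ D ⊓ E :=
        ⟨D.lower (Finset.singleton_subset_iff.2 hi) hs, hE⟩
      rw [h] at this
      exact this
    · intro h
      refine le_bot_iff.1 fun s hs => ?_
      obtain ⟨i, hi⟩ := s.2
      exact (h hs.1 i hi (E.lower (Finset.singleton_subset_iff.2 hi) hs.2)).elim

theorem Cplx.mem_pc {V : Type u} {D : Cplx V} {s : {s : Finset V // s.Nonempty}} :
    s ∈ PAlgebra.pc D ↔ ∀ i ∈ s.1, ⟨{i}, Finset.singleton_nonempty i⟩ ∉ D := Iff.rfl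

theorem Cplx.isPrimeFilter {V : Type u} (s : {s : Finset V // s.Nonempty}) :
    IsPrimeFilter {D : Cplx V | s ∈ D} where
  top_mem := trivial
  bot_notMem := fun h => h
  inf_mem_iff _ _ := Iff.rfl
  sup_mem_iff _ _ := Iff.rfl

theorem Cplx.isUltra {V : Type u} (i : V) :
    IsUltra {D : Cplx V | ⟨{i}, Finset.singleton_nonempty i⟩ ∈ D} where
  toIsPrimeFilter := Cplx.isPrimeFilter _
  mem_or_pc_mem D := by
    simp only [Set.mem_ofPred_eq, Cplx.mem_pc, Finset.mem_singleton, forall_eq]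
    exact em _

/-- The vertices of `s` give the maximal filters needed above the prime filter of `s`; a fixed
vertex `i₀` pads the list when `s` has fewer than `m`. -/
theorem Cplx.exists_isHom_BBar {V : Type u} {m : ℕ} {s : {s : Finset V // s.Nonempty}}
    (hs : s.1.card ≤ m) :
    ∃ f : Cplx V → BBar.{u} m, IsHom f ∧ ∀ D, f D = ⊤ ↔ s ∈ D := by
  obtain ⟨i₀, hi₀⟩ := s.2
  let e := s.1.equivFin
  let g : Fin m → s.1 := fun k =>
    if h : k.1 < s.1.card then e.symm ⟨k.1, h⟩ else ⟨i₀, hi₀⟩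
  refine PAlgebras.exists_isHom_BBar (Cplx.isPrimeFilter s)
    (fun k => {D : Cplx V | ⟨{(g k).1}, Finset.singleton_nonempty _⟩ ∈ D})
    (fun k => Cplx.isUltra _)
    (fun k D hD => D.lower (Finset.singleton_subset_iff.2 (g k).2) hD) ?_
  intro D hD
  obtain ⟨i, hi, hiD⟩ : ∃ i, ∃ _ : i ∈ s.1, ⟨{i}, Finset.singleton_nonempty i⟩ ∈ D := by
    by_contra h
    push Not at h
    exact hD h
  refine ⟨⟨(e ⟨i, hi⟩).1, (e ⟨i, hi⟩).2.trans_le hs⟩, ?_⟩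
  simpa [g] using hiD

/-- The complex of all simplices that miss some vertex. -/
def Cplx.boundary (V : Type u) : Cplx V where
  carrier := {s | ∃ i, i ∉ s.1}
  lower' := fun _ _ hts ⟨i, hi⟩ => ⟨i, fun h => hi (hts h)⟩

/-! ### Homomorphisms from the algebra of complexes. -/

section Hom

variable {A : Type v} [PAlgebra A] {V : Type u} [Fintype V]

open Classical in
/-- The value of a set of vertices under the Boolean homomorphism given by a dense partition. -/
noncomputable def skel (d : V → A) (s : Finset V) : A := sᶜ.inf fun i => pc (d i)

open Classical in
theorem skel_inter (d : V → A) (s t : Finset V) : skel d (s ∩ t) = skel d s ⊓ skel d t := by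
  rw [skel, Finset.compl_inter, Finset.inf_union]; rfl

theorem IsDensePartition.skel_empty {d : V → A} (hd : IsDensePartition d) : skel d ∅ = ⊥ := by
  classical
  rw [skel, Finset.compl_empty, ← pc_finset_sup, hd.pc_sup_eq_bot]

theorem IsDensePartition.le_skel {d : V → A} (hd : IsDensePartition d) {s : Finset V} {i : V}
    (hi : i ∈ s) : d i ≤ skel d s := by
  classical
  refine Finset.le_inf fun j hj => (inf_eq_bot_iff _ _).1 (hd.inf_eq_bot i j ?_)
  rintro rfl
  exact (Finset.mem_compl.1 hj) hi

open Classical in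
/-- The homomorphism from the algebra of complexes given by a dense partition. -/
noncomputable def cplxMap (d : V → A) (D : Cplx V) : A :=
  (Finset.univ.filter fun s : {s : Finset V // s.Nonempty} => s ∈ D).sup fun s => skel d s.1

theorem skel_le_cplxMap (d : V → A) {D : Cplx V} {s : {s : Finset V // s.Nonempty}}
    (hs : s ∈ D) : skel d s.1 ≤ cplxMap d D := by
  classical
  exact Finset.le_sup (f := fun s : {s : Finset V // s.Nonempty} => skel d s.1)
    (Finset.mem_filter.2 ⟨Finset.mem_univ _, hs⟩)

theorem cplxMap_le {d : V → A} {D : Cplx V} {a : A} (h : ∀ s ∈ D, skel d s.1 ≤ a) :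
    cplxMap d D ≤ a := by
  classical
  exact Finset.sup_le fun s hs => h s (Finset.mem_filter.1 hs).2

/-- Meets are preserved because `skel d` turns intersections into meets and, by density, sends `∅`
to `⊥`. -/
theorem IsDensePartition.isHom_cplxMap [Nonempty V] {d : V → A} (hd : IsDensePartition d) :
    IsHom (cplxMap d) where
  map_bot := le_bot_iff.1 (cplxMap_le fun s hs => hs.elim)
  map_top := by
    classical
    refine top_le_iff.1 (le_trans ?_ (skel_le_cplxMap d (D := ⊤)
      (s := ⟨Finset.univ, Finset.univ_nonempty⟩) trivial))
    simp [skel]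
  map_inf D E := by
    classical
    refine le_antisymm (le_inf (cplxMap_le fun s hs => skel_le_cplxMap d hs.1)
      (cplxMap_le fun s hs => skel_le_cplxMap d hs.2)) ?_
    rw [cplxMap, cplxMap, Finset.sup_inf_sup]
    refine Finset.sup_le fun x hx => ?_
    obtain ⟨s, t⟩ := x
    simp only [Finset.mem_product, Finset.mem_filter, Finset.mem_univ, true_and] at hx
    rw [← skel_inter]
    rcases (s.1 ∩ t.1).eq_empty_or_nonempty with h | h
    · rw [h, hd.skel_empty]
      exact bot_le
    · exact skel_le_cplxMap d (D := D ⊓ E) (s := ⟨s.1 ∩ t.1, h⟩)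
        ⟨D.lower (Finset.inter_subset_left (s₁ := s.1) (s₂ := t.1)) hx.1,
          E.lower (Finset.inter_subset_right (s₁ := s.1) (s₂ := t.1)) hx.2⟩
  map_sup D E := by
    refine le_antisymm (cplxMap_le fun s hs => ?_)
      (sup_le (cplxMap_le fun s hs => skel_le_cplxMap d (Or.inl hs))
        (cplxMap_le fun s hs => skel_le_cplxMap d (Or.inr hs)))
    exact hs.elim (fun h => (skel_le_cplxMap d h).trans le_sup_left)
      (fun h => (skel_le_cplxMap d h).trans le_sup_right)
  map_pc D := by
    classical
    apply le_antisymm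
    · refine cplxMap_le fun s hs => le_pc_comm.1 (cplxMap_le fun t ht => ?_)
      have hst : t.1 ∩ s.1 = ∅ := by
        refine Finset.eq_empty_of_forall_notMem fun i hi => ?_
        rw [Finset.mem_inter] at hi
        exact hs i hi.2 (D.lower (Finset.singleton_subset_iff.2 hi.1) ht)
      rw [← inf_eq_bot_iff, ← skel_inter, hst, hd.skel_empty]
    -- `T`, the set of non-vertices of `D`, is the largest simplex of `pc D` when nonempty.
    · let T : Finset V := Finset.univ.filter fun i => ⟨{i}, Finset.singleton_nonempty i⟩ ∉ D
      have h : pc (cplxMap d D) ≤ skel d T := by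
        refine Finset.le_inf fun i hi => pc_anti ?_
        have hi' : (⟨{i}, Finset.singleton_nonempty i⟩ : {s : Finset V // s.Nonempty}) ∈ D := by
          simpa [T] using hi
        exact (hd.le_skel (Finset.mem_singleton_self i)).trans (skel_le_cplxMap d hi')
      rcases T.eq_empty_or_nonempty with hT | hT
      · rw [hT, hd.skel_empty] at h
        exact h.trans bot_le
      · exact h.trans (skel_le_cplxMap d (D := PAlgebra.pc D) (s := ⟨T, hT⟩)
          fun i hi => (Finset.mem_filter.1 hi).2)

theorem cplxMap_boundary_le (d : V → A) :
    cplxMap d (Cplx.boundary V) ≤ Finset.univ.sup fun i => pc (d i) := by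
  classical
  refine cplxMap_le ?_
  rintro s ⟨i, hi⟩
  exact (Finset.inf_le (by simpa using hi)).trans
    (Finset.le_sup (f := fun i => pc (d i)) (Finset.mem_univ i))

end Hom

theorem Cplx.exists_mem_iff_not_mem {V : Type u} {D E : Cplx V} (h : D ≠ E) :
    ∃ s, ¬ (s ∈ D ↔ s ∈ E) := by
  by_contra hcon
  push Not at hcon
  exact h (SetLike.ext hcon)

/-- Every quasivariety properly containing `Pa m` contains the algebra of complexes on `m + 1`
vertices. -/
theorem Cplx_mem_of_lt {m : ℕ} {L : Subquasivariety.{u}} (hL : Pa.{u} m < L) :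
    (⟨Cplx (ULift.{u} (Fin (m + 1)))⟩ : PAlg.{u}) ∈ L.carrier := by
  obtain ⟨hle, hnle⟩ := lt_iff_le_not_ge.1 hL
  obtain ⟨A, hAL, hA⟩ := Set.not_subset.1 hnle
  obtain ⟨p, M, hp, hM, hpM, hinj⟩ := exists_isUltra_of_notMem_Pa hA
  obtain ⟨d, hd, hdM⟩ := exists_isDensePartition (V := ULift.{u} (Fin (m + 1)))
    (fun i => M i.down) (fun i => hM _) (hinj.comp ULift.down_injective)
  -- Were the images equal, the prime filter `p` would contain some `pc (d i)`, contradicting `d i ∈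
  -- M i` and `p ⊆ M i`.
  have hne : cplxMap d ⊤ ≠ cplxMap d (Cplx.boundary _) := by
    intro h
    rw [hd.isHom_cplxMap.map_top] at h
    have h1 := hp.mono (cplxMap_boundary_le d) (h ▸ hp.top_mem)
    obtain ⟨i, -, hi⟩ := (hp.finset_sup_mem_iff _ _).1 h1
    exact (hM i.down).pc_notMem (hdM i) (hpM _ hi)
  have hB : (⟨BBar.{u} m⟩ : PAlg.{u}) ∈ L.carrier := hle (BBar_mem_Pa m)
  obtain ⟨E, hE⟩ := L.isQuasivariety
  rw [hE] at hAL hB ⊢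
  intro q hq
  refine q.holds_of_separating fun x y hxy => ?_
  by_cases hs : ∃ s : {s : Finset (ULift.{u} (Fin (m + 1))) // s.Nonempty},
      s.1.card ≤ m ∧ ¬ (s ∈ x ↔ s ∈ y)
  · obtain ⟨s, hsm, hsxy⟩ := hs
    obtain ⟨f, hf, hfs⟩ := Cplx.exists_isHom_BBar hsm
    refine ⟨⟨BBar.{u} m⟩, hB q hq, f, hf, fun h => hsxy ?_⟩
    rw [← hfs, ← hfs, h]
  · push Not at hs
    refine ⟨A, hAL q hq, cplxMap d, hd.isHom_cplxMap, ?_⟩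
    have hfull : ∀ s : {s : Finset (ULift.{u} (Fin (m + 1))) // s.Nonempty},
        m < s.1.card → s.1 = Finset.univ := by
      intro s hs
      apply Finset.eq_univ_of_card
      have := s.1.card_le_univ
      simp only [Fintype.card_ulift, Fintype.card_fin] at this ⊢
      omega
    let F : {s : Finset (ULift.{u} (Fin (m + 1))) // s.Nonempty} :=
      ⟨Finset.univ, Finset.univ_nonempty⟩
    -- The full simplex is the only one with more than `m` vertices, so complexes differing only
    -- there are `⊤` and the boundary.
    have main : ∀ x y : Cplx (ULift.{u} (Fin (m + 1))), F ∈ x → F ∉ y →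
        (∀ s, s.1.card ≤ m → (s ∈ x ↔ s ∈ y)) → x = ⊤ ∧ y = Cplx.boundary _ := by
      intro x y hx hy hs
      have hxtop : ∀ s, s ∈ x := fun s => x.lower (Finset.subset_univ s.1) hx
      refine ⟨SetLike.ext fun s => iff_of_true (hxtop s) trivial, SetLike.ext fun s => ?_⟩
      constructor
      · intro h
        by_contra hb
        have : s = F := Subtype.ext (Finset.eq_univ_of_forall fun i => by
          by_contra hi
          exact hb ⟨i, hi⟩)
        exact hy (this ▸ h)
      · rintro ⟨i, hi⟩
        refine (hs s ?_).1 (hxtop s)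
        by_contra hc
        exact hi (hfull s (not_le.1 hc) ▸ Finset.mem_univ i)
    obtain ⟨s, hsxy⟩ := Cplx.exists_mem_iff_not_mem hxy
    have hsF : s = F := Subtype.ext (hfull s (not_le.1 fun h => hsxy (hs s h)))
    subst hsF
    by_cases hx : F ∈ x
    · have hy : F ∉ y := fun hy => hsxy (iff_of_true hx hy)
      obtain ⟨rfl, rfl⟩ := main x y hx hy hs
      exact hne
    · have hy : F ∈ y := by_contra fun hy => hsxy (iff_of_false hx hy)
      obtain ⟨rfl, rfl⟩ := main y x hy hx fun s h => (hs s h).symm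
      exact hne.symm

/-! ### Lee's identities -/

/-- The left-hand side of Lee's identity, in the form `⋁ᵢ (xᵢ ∧ ⋀_{j ≠ i} xⱼ*)* = 1`. -/
def lee {A : Type v} [PAlgebra A] {n : ℕ} (x : Fin n → A) : A :=
  Finset.univ.sup fun i => pc (x i ⊓ (Finset.univ.erase i).inf fun j => pc (x j))

theorem IsHom.map_lee {A : Type v} {B : Type w} [PAlgebra A] [PAlgebra B] {f : A → B}
    (hf : IsHom f) {n : ℕ} (x : Fin n → A) : f (lee x) = lee fun i => f (x i) := by
  simp only [lee]
  rw [Finset.apply_sup_eq_sup_comp f hf.map_sup hf.map_bot]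
  congr 1
  funext i
  simp only [Function.comp_apply, hf.map_pc, hf.map_inf]
  rw [Finset.apply_inf_eq_inf_comp f hf.map_inf hf.map_top]
  simp only [Function.comp_def, hf.map_pc]

/-- If the join were not `⊤`, the `m + 1` pairwise disjoint elements `e i` would all be nonzero,
hence contain distinct atoms. -/
theorem lee_BBar {m : ℕ} (hm : 1 ≤ m) (x : Fin (m + 1) → BBar.{u} m) : lee x = ⊤ := by
  by_contra hne
  set e : Fin (m + 1) → BBar.{u} m := fun i =>
    x i ⊓ (Finset.univ.erase i).inf fun j => pc (x j) with he
  have hbot : ∀ i, e i ≠ ⊥ := by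
    intro i hi
    refine hne (top_le_iff.1 (le_trans ?_
      (Finset.le_sup (f := fun i => pc (e i)) (Finset.mem_univ i))))
    rw [hi, pc_bot]
  have hdisj : ∀ i j, i ≠ j → e i ⊓ e j = ⊥ := by
    intro i j hij
    have h1 : e i ≤ pc (x j) := inf_le_right.trans (Finset.inf_le (by simpa using hij.symm))
    have h2 : e j ≤ x j := inf_le_left
    exact le_bot_iff.1 ((inf_le_inf h1 h2).trans (by rw [inf_comm, inf_pc_self]))
  have hatom : ∀ i, ∃ k : ULift.{u} (Fin m), (({k} : Set _) : BBar.{u} m) ≤ e i := by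
    intro i
    have hi := hbot i
    generalize e i = a at hi
    induction a using WithTop.recTopCoe with
    | top => exact ⟨⟨⟨0, hm⟩⟩, le_top⟩
    | coe s =>
      have hs : s.Nonempty := by
        rw [Set.nonempty_iff_ne_empty]
        rintro rfl
        exact hi rfl
      obtain ⟨k, hk⟩ := hs
      exact ⟨k, WithTop.coe_le_coe.2 (Set.singleton_subset_iff.2 hk)⟩
  choose k hk using hatom
  have hinj : Function.Injective k := by
    intro i j hij
    by_contra hne'
    have h := le_inf (hk i) (hij ▸ hk j)
    rw [hdisj i j hne'] at h
    have : ({k i} : Set (ULift.{u} (Fin m))) ⊆ ∅ := WithTop.coe_le_coe.1 h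
    exact this rfl
  have := Fintype.card_le_of_injective k hinj
  simp at this

theorem lee_eq_top_of_mem_Pa {m : ℕ} (hm : 1 ≤ m) {A : PAlg.{u}} (hA : A ∈ (Pa.{u} m).carrier)
    (x : Fin (m + 1) → A.carrier) : lee x = ⊤ := by
  obtain ⟨B, ⟨C, ⟨I, F, hF, e, he, hinj⟩, g, hg, hginj⟩, f, hf, hsurj⟩ := hA
  choose y hy using fun i => hsurj (x i)
  obtain rfl : (fun i => f (y i)) = x := funext hy
  rw [← hf.map_lee, ← hf.map_top]
  congr 1
  apply hginj
  rw [hg.map_lee, hg.map_top]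
  apply hinj.1
  rw [he.map_lee, he.map_top]
  funext i
  refine ((isHom_apply (fun i => (F i).carrier) i).map_lee _).trans ?_
  have hi : F i = ⟨BBar.{u} m⟩ := hF i
  -- A general `G` allows the equation between bundled algebras to be substituted.
  have key : ∀ G : PAlg.{u}, G = ⟨BBar.{u} m⟩ → ∀ z : Fin (m + 1) → G.carrier, lee z = ⊤ := by
    rintro _ rfl z
    exact lee_BBar hm z
  exact key _ hi _

theorem Cplx_notMem_Pa {m : ℕ} (hm : 1 ≤ m) :
    (⟨Cplx (ULift.{u} (Fin (m + 1)))⟩ : PAlg.{u}) ∉ (Pa.{u} m).carrier := by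
  intro h
  -- With `x i` the single vertex `i`, the `i`-th joinand misses that vertex. So no joinand contains
  -- the full simplex, whose filter is prime.
  let x : Fin (m + 1) → Cplx (ULift.{u} (Fin (m + 1))) := fun i =>
    LowerSet.Iic ⟨{⟨i⟩}, Finset.singleton_nonempty _⟩
  have htop : lee x = ⊤ := lee_eq_top_of_mem_Pa hm h x
  have hp := Cplx.isPrimeFilter
    (⟨Finset.univ, Finset.univ_nonempty⟩ :
      {s : Finset (ULift.{u} (Fin (m + 1))) // s.Nonempty})
  have hmem := hp.top_mem
  rw [← htop, lee, hp.finset_sup_mem_iff] at hmem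
  obtain ⟨i, -, hi⟩ := hmem
  refine hi ⟨i⟩ (Finset.mem_univ _) ⟨LowerSet.mem_Iic_iff.2 le_rfl, ?_⟩
  refine ((Cplx.isUltra (⟨i⟩ : ULift.{u} (Fin (m + 1)))).finset_inf_mem_iff _ _).2 ?_
  intro j hj
  have hji : j ≠ i := Finset.ne_of_mem_erase hj
  refine (Cplx.isUltra _).pc_mem_iff.2 fun hle => hji ?_
  have hsub : ({⟨i⟩} : Finset (ULift.{u} (Fin (m + 1)))) ⊆ {⟨j⟩} := hle
  simpa [eq_comm] using hsub

/-- The least quasivariety containing `Pa m` and the p-algebra `C`. -/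
def paSup (m : ℕ) (C : PAlg.{u}) : Subquasivariety.{u} where
  carrier := {A | ∀ q ∈ {q : QuasiIdentity | (∀ B ∈ (Pa.{u} m).carrier, q.Holds B.carrier) ∧
    q.Holds C.carrier}, q.Holds A.carrier}
  isQuasivariety := ⟨_, rfl⟩

theorem Pa_le_paSup (m : ℕ) (C : PAlg.{u}) : Pa.{u} m ≤ paSup m C :=
  fun A hA _ hq => hq.1 A hA

theorem mem_paSup (m : ℕ) (C : PAlg.{u}) : C ∈ (paSup m C).carrier :=
  fun _ hq => hq.2

theorem paSup_le {m : ℕ} {C : PAlg.{u}} {L : Subquasivariety.{u}} (hL : Pa.{u} m ≤ L)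
    (hC : C ∈ L.carrier) : paSup m C ≤ L := by
  intro A hA
  have hle : ∀ B ∈ (Pa.{u} m).carrier, B ∈ L.carrier := fun B hB => hL hB
  obtain ⟨E, hE⟩ := L.isQuasivariety
  rw [hE] at hC hle ⊢
  exact fun q hq => hA q ⟨fun B hB => hle B hB q hq, hC q hq⟩

end PAlgebras

theorem theorem3p6 (m : ℕ) (hm : 2 ≤ m) :
    ∃! K : PAlgebras.Subquasivariety.{u}, PAlgebras.Pa.{u} m ⋖ K := by
  have hm' : 1 ≤ m := one_le_two.trans hm
  let C : PAlgebras.PAlg.{u} := ⟨PAlgebras.Cplx (ULift.{u} (Fin (m + 1)))⟩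
  have hlt : PAlgebras.Pa.{u} m < PAlgebras.paSup m C :=
    lt_of_le_not_ge (PAlgebras.Pa_le_paSup m C) fun h =>
      PAlgebras.Cplx_notMem_Pa hm' (h (PAlgebras.mem_paSup m C))
  -- A least element strictly above `Pa m` is automatically its only cover.
  have hmin : ∀ L, PAlgebras.Pa.{u} m < L → PAlgebras.paSup m C ≤ L := fun L hL =>
    PAlgebras.paSup_le hL.le (PAlgebras.Cplx_mem_of_lt hL)
  refine ⟨PAlgebras.paSup m C, ⟨hlt, fun L hL hL' => hL'.not_ge (hmin L hL)⟩, fun L hL => ?_⟩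
  exact ((hmin L hL.lt).eq_of_not_lt fun h => hL.2 hlt h).symm
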